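/- Let $\Omega\subset\mathbb R^2$ be a bounded domain with smooth boundary, and let $\omega\in\mathbb R$, $\omega\neq 0$. Let $\Omega_1,\dots,\Omega_J$ be a strongly overlapping decomposition of $\Omega$: there are pairwise disjoint open sets $D_j\subset\Omega$ with $\Omega\subset\bigcup_j\overline{D_j}$ and a $\delta>0$ such that each $\Omega_j\subset\Omega$ is open and contains all points of $\Omega$ at distance less than $\delta$ from $D_j$. Put $\Gamma_j=\partial\Omega_j\cap\Omega$. Let $\chi_1,\dots,\chi_J\ge 0$ be a smooth partition of unity on $\Omega$ such that the support $K_j$ of $\chi_j$ in $\Omega$ is contained in $\Omega_j$ and has positive distance from $\Gamma_j$. Then there is a constant $\gamma\in[0,1)$, depending only on $\omega,\Omega,(\Omega_j),(\chi_j)$, such that the following hold. (a) For every $j$ and every $e\in C^2(\Omega_j)\cap C^0(\overline{\Omega_j})$ with $\Delta e-i\omega e=0$ in $\Omega_j$ and $e=0$ on $\overline{\Omega_j}\cap\partial\Omega$, one has $\|e\|_{K_j}\le\gamma\,\|e\|_{\Gamma_j}$, where $\|\cdot\|_S$ is the supremum norm on $S$. (b) Let $f\in C^\infty(\Omega)\cap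 C^0(\overline\Omega)$ be complex valued, and let $u\in C^2(\Omega)\cap C^0(\overline\Omega)$ solve $\Delta u-i\omega u=f$ in $\Omega$, $u=0$ on $\partial\Omega$. Let $u^0_{\rm glob}\in C^2(\Omega)\cap C^0(\overline\Omega)$, and let $u_j^{n+1}\in C^2(\Omega_j)\cap C^0(\overline{\Omega_j})$ and $u^{n+1}_{\rm glob}$ ($n\ge 0$, $1\le j\le J$) be iterates of the parallel Schwarz method $$\Delta u_j^{n+1}-i\omega u_j^{n+1}=f\ \text{ in }\Omega_j,\qquad u_j^{n+1}=0\ \text{ on }\overline{\Omega_j}\cap\partial\Omega,\qquad u_j^{n+1}=u^n_{\rm glob}\ \text{ on }\Gamma_j,$$ $$u^{n+1}_{\rm glob}=\sum_{j=1}^J\chi_j u_j^{n+1}\ \text{ in }\Omega.$$ Then the method converges: $\max_j\|u-u_j^n\|_{\Omega_j}\to0$ and $\|u-u^n_{\rm glob}\|_{\Omega}\to0$ as $n\to\infty$. Moreover $\max_j\|u-u_j^1\|_{\Omega_j}\le\|u-u^0_{\rm glob}\|_\Omega$, and for all $n\ge0$ $$\max_j\|u-u_j^{n+1}\|_{\Omega_j}\le\gamma^n\max_j\|u-u_j^1\|_{\Omega_j}.$$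 If in addition the initial guess is $u^0_{\rm glob}=\sum_j\chi_ju^0_j$ in $\Omega$ with local functions $u_j^0\in C^2(\Omega_j)\cap C^0(\overline{\Omega_j})$ satisfying $\Delta u^0_j-i\omega u^0_j=f$ in $\Omega_j$ and $u^0_j=0$ on $\overline{\Omega_j}\cap\partial\Omega$, then for all $n\ge0$ $$\max_j\|u-u_j^{n}\|_{\Omega_j}\le\gamma^n\max_j\|u-u_j^0\|_{\Omega_j}.$$ -/

import Mathlib

open scoped ENNReal NNReal

namespace SchwarzMT

/-- The Euclidean plane. -/
abbrev Plane : Type := EuclideanSpace ℝ (Fin 2)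

/-- The boundary of `Ω` is smooth: near each boundary point, `Ω` is the set where a smooth
function with non-vanishing derivative is negative. -/
def HasSmoothBoundary (Ω : Set Plane) : Prop :=
  ∀ p ∈ frontier Ω, ∃ (V : Set Plane) (ρ : Plane → ℝ), IsOpen V ∧ p ∈ V ∧
    ContDiffOn ℝ (⊤ : ℕ∞) ρ V ∧ (∀ x ∈ V, fderiv ℝ ρ x ≠ 0) ∧ Ω ∩ V = {x ∈ V | ρ x < 0}

/-- A bounded domain (non-empty connected open set) with smooth boundary. -/
structure IsSmoothBoundedDomain (Ω : Set Plane) : Prop where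
  isOpen : IsOpen Ω
  isConnected : IsConnected Ω
  isBounded : Bornology.IsBounded Ω
  smooth : HasSmoothBoundary Ω

/-- The class `C²(U) ∩ C⁰(closure U)`. -/
def ClassicalReg (U : Set Plane) (u : Plane → ℂ) : Prop :=
  ContDiffOn ℝ 2 u U ∧ ContinuousOn u (closure U)

/-- `u ∈ C²(U) ∩ C⁰(closure U)` is a classical solution of `Δu - iωu = f` in `U`. -/
def SolvesIn (ω : ℝ) (f : Plane → ℂ) (U : Set Plane) (u : Plane → ℂ) : Prop :=
  ClassicalReg U u ∧
    ∀ x ∈ U, Laplacian.laplacian u x - Complex.I * (ω : ℂ) * u x = f x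

/-- `u` is the classical solution of the global problem `Δu - iωu = f` in `Ω`, `u = 0` on `∂Ω`. -/
def SolvesGlobal (ω : ℝ) (f : Plane → ℂ) (Ω : Set Plane) (u : Plane → ℂ) : Prop :=
  SolvesIn ω f Ω u ∧ ∀ x ∈ frontier Ω, u x = 0

/-- The equation in the subdomain `U ⊆ Ω` with the homogeneous Dirichlet condition on the part of
the outer boundary `∂Ω` that belongs to the closure of `U`
(no condition on the part of `∂U` inside `Ω`). -/
def SolvesLocal (ω : ℝ) (f : Plane → ℂ) (Ω U : Set Plane) (u : Plane → ℂ) : Prop :=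
  SolvesIn ω f U u ∧ ∀ x ∈ closure U ∩ frontier Ω, u x = 0

/-- The interface of the subdomain `U`: the portion of `∂U` inside `Ω`. -/
def interface (Ω U : Set Plane) : Set Plane := frontier U ∩ Ω

/-- The subdomains `Ωs j` form a strongly overlapping decomposition of `Ω`: they are open subsets of
`Ω` that arise from the parts `D j` of a non-overlapping decomposition of `Ω`
by adding a layer of positive width (at least `δ`). -/
def StronglyOverlapping {J : ℕ} (Ω : Set Plane) (Ωs : Fin J → Set Plane) : Prop :=
  (∀ j, IsOpen (Ωs j) ∧ Ωs j ⊆ Ω) ∧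
    ∃ (D : Fin J → Set Plane) (δ : ℝ), 0 < δ ∧
      (∀ j, IsOpen (D j) ∧ D j ⊆ Ω) ∧
      Pairwise (fun j k => Disjoint (D j) (D k)) ∧
      Ω ⊆ ⋃ j, closure (D j) ∧
      ∀ j, Metric.thickening δ (D j) ∩ Ω ⊆ Ωs j

/-- The support in `Ω` (the closure relative to `Ω`) of a function on `Ω`. -/
def supportIn (Ω : Set Plane) (χ : Plane → ℝ) : Set Plane :=
  closure (Ω ∩ Function.support χ) ∩ Ω

/-- A smooth partition of unity on `Ω` subordinate to the `Ωs j`. The support of `χ j` in `Ω`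
is contained in `Ωs j` and has a positive distance from the interface of `Ωs j`. -/
structure IsPartition {J : ℕ} (Ω : Set Plane) (Ωs : Fin J → Set Plane)
    (χ : Fin J → Plane → ℝ) : Prop where
  smooth : ∀ j, ContDiffOn ℝ (⊤ : ℕ∞) (χ j) Ω
  nonneg : ∀ j, ∀ x ∈ Ω, 0 ≤ χ j x
  sum_eq_one : ∀ x ∈ Ω, ∑ j, χ j x = 1
  support_subset : ∀ j, supportIn Ω (χ j) ⊆ Ωs j
  support_dist : ∀ j, ∃ d : ℝ, 0 < d ∧
    ∀ x ∈ supportIn Ω (χ j), ∀ y ∈ interface Ω (Ωs j), d ≤ dist x y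

/-- `v` is, on `Ω`, the global function `∑ j, χ j * w j` assembled from local functions `w j`. -/
def IsAssembled {J : ℕ} (Ω : Set Plane) (χ : Fin J → Plane → ℝ)
    (w : Fin J → Plane → ℂ) (v : Plane → ℂ) : Prop :=
  ∀ x ∈ Ω, v x = ∑ j, (χ j x : ℂ) * w j x

/-- The parallel Schwarz method. `uglob n` is the `n`-th global approximation, `uloc n j` the
`n`-th approximation in the `j`-th subdomain (which the method determines for `n ≥ 1` only). -/
structure IsSchwarz {J : ℕ} (ω : ℝ) (f : Plane → ℂ) (Ω : Set Plane) (Ωs : Fin J → Set Plane)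
    (χ : Fin J → Plane → ℝ) (uglob : ℕ → Plane → ℂ) (uloc : ℕ → Fin J → Plane → ℂ) : Prop where
  init : ClassicalReg Ω (uglob 0)
  solves : ∀ n j, SolvesLocal ω f Ω (Ωs j) (uloc (n + 1) j)
  transmission : ∀ n j, ∀ x ∈ interface Ω (Ωs j), uloc (n + 1) j x = uglob n x
  assemble : ∀ n, IsAssembled Ω χ (uloc (n + 1)) (uglob (n + 1))

/-- The supremum norm on a set, with values in `[0, ∞]`. -/
noncomputable def supNorm (S : Set Plane) (v : Plane → ℂ) : ℝ≥0∞ := ⨆ x ∈ S, ‖v x‖ₑ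

/-- The largest of the errors `‖u - w j‖` in the supremum norms on the subdomains. -/
noncomputable def maxErr {J : ℕ} (Ωs : Fin J → Set Plane) (u : Plane → ℂ)
    (w : Fin J → Plane → ℂ) : ℝ≥0∞ := ⨆ j, supNorm (Ωs j) (fun x => u x - w j x)

end SchwarzMT

/-!
The contraction factor comes from estimates on the modulus of a solution `e` of `Δe = iωe` in a
subdomain `U ⊆ Ω` that vanishes on the outer boundary. Since `Re (ē · iωe) = 0`, the function `|e|²`
is subharmonic: `Δ|e|² = 2|∇e|²`. Adding a positive multiple of `|y - q|⁻²`, which is strictly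
subharmonic in the plane away from `q`, excludes interior maxima
(`barrier_maximum_principle`), so `|e| ≤ M`, where `M` is the supremum of `|e|` over the interface
(`SolvesLocal.norm_le`). A strict contraction near a point `p` of the closure of the support `K` of
the cut-off function is obtained in one of two ways.

* If `p ∈ Ω`, a ball around `p` lies in `U`. The circle means `m(r)` of `e` satisfy the Bessel
  equation `(r m')' = iω r m`, hence `m(r) = (1 + iωr²/4) m(0) + O(r⁴)`. The coefficient has modulus
  `1 + (ωr²/4)²/2 + …`, which exceeds the remainder, whose constant is `M (ωr²/4)²/4`. As
  `|m(r)| ≤ M`, this gives `|e(p)| ≤ γM` with `γ < 1` (`exists_interior_factor`); this step uses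
  `ω ≠ 0`.
* If `p ∈ ∂Ω`, smoothness of the boundary provides a point `q` outside the closure of `Ω`, as close
  to `p` as desired. In a disc around `q` that does not meet the interface, `|e|²` is compared with
  a multiple of `s⁻² - |y - q|⁻²`, where `s ≤ dist (q, Ω)`
  (`SolvesLocal.norm_sq_le_barrier`, `hasFactorOn_near_frontier`).

Compactness of the closure of `K` makes the factor uniform (`hasFactorOn_of_dist_interface`).

For the Schwarz method, the local errors solve the homogeneous problem. On an interface a new local
error equals `u - uglob n`, which is a convex combination of the old local errors taken at points of
the supports of the cut-off functions, where they are at most `γ` times their suprema over the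
interfaces.
-/

namespace SchwarzMT

open Set Metric Filter Topology MeasureTheory

/-! ### Derivatives of twice differentiable functions in the plane -/

lemma laplacian_eq_fderiv_fderiv (e : Plane → ℂ) (x : Plane) :
    Laplacian.laplacian e x =
      fderiv ℝ (fderiv ℝ e) x (EuclideanSpace.single 0 1) (EuclideanSpace.single 0 1) +
      fderiv ℝ (fderiv ℝ e) x (EuclideanSpace.single 1 1) (EuclideanSpace.single 1 1) := by
  have h := congrFun (InnerProductSpace.laplacian_eq_iteratedFDeriv_orthonormalBasis e
    (EuclideanSpace.basisFun (Fin 2) ℝ)) x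
  simp only [iteratedFDeriv_two_apply, Fin.sum_univ_two, EuclideanSpace.basisFun_apply] at h
  simpa using h

lemma hasFDerivAt_of_contDiffOn {U : Set Plane} (hU : IsOpen U) {e : Plane → ℂ}
    (he : ContDiffOn ℝ 2 e U) {x : Plane} (hx : x ∈ U) :
    HasFDerivAt e (fderiv ℝ e x) x :=
  ((he.contDiffAt (hU.mem_nhds hx)).differentiableAt (by norm_num)).hasFDerivAt

lemma contDiffOn_fderiv {U : Set Plane} (hU : IsOpen U) {e : Plane → ℂ}
    (he : ContDiffOn ℝ 2 e U) : ContDiffOn ℝ 1 (fderiv ℝ e) U :=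
  he.fderiv_of_isOpen hU (by norm_num)

lemma hasFDerivAt_fderiv_of_contDiffOn {U : Set Plane} (hU : IsOpen U) {e : Plane → ℂ}
    (he : ContDiffOn ℝ 2 e U) {x : Plane} (hx : x ∈ U) :
    HasFDerivAt (fderiv ℝ e) (fderiv ℝ (fderiv ℝ e) x) x :=
  (((contDiffOn_fderiv hU he).contDiffAt (hU.mem_nhds hx)).differentiableAt
    (by norm_num)).hasFDerivAt

lemma hasDerivAt_fderiv_comp {U : Set Plane} (hU : IsOpen U) {e : Plane → ℂ}
    (he : ContDiffOn ℝ 2 e U) {g w : ℝ → Plane} {g' w' : Plane} {t : ℝ}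
    (hg : HasDerivAt g g' t) (hw : HasDerivAt w w' t) (hx : g t ∈ U) :
    HasDerivAt (fun t => fderiv ℝ e (g t) (w t))
      (fderiv ℝ (fderiv ℝ e) (g t) g' (w t) + fderiv ℝ e (g t) w') t := by
  have h : HasDerivAt (fun t => fderiv ℝ e (g t)) (fderiv ℝ (fderiv ℝ e) (g t) g') t :=
    (hasFDerivAt_fderiv_of_contDiffOn hU he hx).comp_hasDerivAt t hg
  exact h.clm_apply hw

/-! ### The maximum principle -/

/-- The necessary second-order condition at a local maximum. -/
lemma second_deriv_nonpos_of_isLocalMax {φ φ' : ℝ → ℝ} {c : ℝ} (hmax : IsLocalMax φ 0)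
    (h1 : ∀ᶠ t in 𝓝 0, HasDerivAt φ (φ' t) t) (h2 : HasDerivAt φ' c 0) : c ≤ 0 := by
  by_contra! hc
  have hd : deriv φ =ᶠ[𝓝 0] φ' := h1.mono fun t ht => ht.deriv
  have hdd : deriv (deriv φ) 0 = c := by rw [hd.deriv_eq, h2.deriv]
  have hmin : IsLocalMin φ 0 :=
    isLocalMin_of_deriv_deriv_pos (by rw [hdd]; exact hc) hmax.deriv_eq_zero
      h1.self_of_nhds.continuousAt
  have hconst : φ =ᶠ[𝓝 0] fun _ => φ 0 := by
    filter_upwards [hmax, hmin] with t h h' using le_antisymm h h'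
  have h0 : deriv φ =ᶠ[𝓝 0] fun _ => (0 : ℝ) := by
    simpa using hconst.deriv
  have : deriv (deriv φ) 0 = 0 := by rw [h0.deriv_eq]; simp
  linarith

lemma hasDerivAt_line (y v : Plane) (t : ℝ) : HasDerivAt (fun t : ℝ => y + t • v) v t := by
  simpa using ((hasDerivAt_id t).smul_const v).const_add y

/-- At a local maximum of `|e|² + β|z - q|⁻²`, the second derivative of this function in the
direction `v` is nonpositive. Here it is written out. -/
lemma second_deriv_line_nonpos {V : Set Plane} (hV : IsOpen V) {e : Plane → ℂ}
    (he : ContDiffOn ℝ 2 e V) {q : Plane} (hq : q ∉ V) {β : ℝ} {y : Plane} (hy : y ∈ V)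
    (hmax : IsLocalMax (fun z => ‖e z‖ ^ 2 + β * (‖z - q‖ ^ 2)⁻¹) y) (v : Plane) :
    2 * (inner ℝ (fderiv ℝ e y v) (fderiv ℝ e y v) + inner ℝ (e y) (fderiv ℝ (fderiv ℝ e) y v v))
      + β * (8 * inner ℝ (y - q) v ^ 2 / (‖y - q‖ ^ 2) ^ 3 - 2 * ‖v‖ ^ 2 / (‖y - q‖ ^ 2) ^ 2)
      ≤ 0 := by
  have hline : ContinuousAt (fun t : ℝ => y + t • v) 0 := (hasDerivAt_line y v 0).continuousAt
  have hmem : ∀ᶠ t : ℝ in 𝓝 0, y + t • v ∈ V := by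
    apply hline.eventually_mem
    simpa using hV.mem_nhds hy
  have hne : ∀ z ∈ V, ‖z - q‖ ^ 2 ≠ 0 := by
    intro z hz h
    apply hq
    have : z = q := by simpa [sub_eq_zero] using h
    exact this ▸ hz
  -- first derivative along the line
  have hE : ∀ t : ℝ, y + t • v ∈ V →
      HasDerivAt (fun t : ℝ => e (y + t • v)) (fderiv ℝ e (y + t • v) v) t := fun t ht =>
    (hasFDerivAt_of_contDiffOn hV he ht).comp_hasDerivAt t (hasDerivAt_line y v t)
  have hE' : HasDerivAt (fun t : ℝ => fderiv ℝ e (y + t • v) v)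
      (fderiv ℝ (fderiv ℝ e) y v v) 0 := by
    have hy0 : y + (0 : ℝ) • v ∈ V := by simpa using hy
    have := hasDerivAt_fderiv_comp hV he (hasDerivAt_line y v 0) (hasDerivAt_const (0 : ℝ) v) hy0
    simpa using this
  have hN : ∀ t : ℝ, HasDerivAt (fun t : ℝ => y + t • v - q) v t := fun t =>
    (hasDerivAt_line y v t).sub_const q
  refine second_deriv_nonpos_of_isLocalMax
    (φ := fun t : ℝ => ‖e (y + t • v)‖ ^ 2 + β * (‖y + t • v - q‖ ^ 2)⁻¹)
    (φ' := fun t : ℝ => 2 * inner ℝ (e (y + t • v)) (fderiv ℝ e (y + t • v) v) +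
      β * (-(2 * inner ℝ (y + t • v - q) v) / (‖y + t • v - q‖ ^ 2) ^ 2)) ?_ ?_ ?_
  · have h0 : y + (0 : ℝ) • v = y := by simp
    have ht : Tendsto (fun t : ℝ => y + t • v) (𝓝 0) (𝓝 y) := by
      simpa using hline.tendsto
    change ∀ᶠ t in 𝓝 (0 : ℝ), _
    filter_upwards [ht.eventually hmax] with t h
    simpa using h
  · filter_upwards [hmem] with t ht
    exact (hE t ht).norm_sq.add (((hN t).norm_sq.inv (hne _ ht)).const_mul β)
  · have hy0 : y + (0 : ℝ) • v = y := by simp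
    have hN2 := ((hN 0).inner ℝ (hasDerivAt_const (0 : ℝ) v)).const_mul 2 |>.neg.div
      ((hN 0).norm_sq.pow 2) (pow_ne_zero 2 (by simpa using hne y hy))
    have hE2 := ((hE 0 (by simpa using hy)).inner ℝ hE').const_mul 2
    refine (hE2.add (hN2.const_mul β)).congr_deriv ?_
    have := hne y hy
    simp only [zero_smul, add_zero, inner_zero_right, Pi.neg_apply, Pi.pow_apply, Nat.cast_ofNat,
      zero_add, real_inner_self_eq_norm_sq]
    generalize ‖y - q‖ ^ 2 = N at this ⊢
    field_simp
    ring

/-- The weak maximum principle for `|e|² + β|z - q|⁻²`, where `Δe = iωe`. The sum of the second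
derivatives along the two coordinate axes is `2|∇e|² + 4β|z - q|⁻⁴ > 0`, so there is no interior
maximum. -/
theorem barrier_maximum_principle {V : Set Plane} (hV : IsOpen V) (hb : Bornology.IsBounded V)
    {e : Plane → ℂ} {ω : ℝ} (he : ContDiffOn ℝ 2 e V) (hc : ContinuousOn e (closure V))
    (hpde : ∀ x ∈ V, Laplacian.laplacian e x = Complex.I * ω * e x)
    {q : Plane} (hq : q ∉ closure V) {β C : ℝ} (hβ : 0 < β)
    (hfr : ∀ y ∈ frontier V, ‖e y‖ ^ 2 + β * (‖y - q‖ ^ 2)⁻¹ ≤ C) {x : Plane} (hx : x ∈ V) :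
    ‖e x‖ ^ 2 + β * (‖x - q‖ ^ 2)⁻¹ ≤ C := by
  have hne : ∀ z ∈ closure V, ‖z - q‖ ^ 2 ≠ 0 := by
    intro z hz h
    have : z = q := by simpa [sub_eq_zero] using h
    exact hq (this ▸ hz)
  have hcont : ContinuousOn (fun z => ‖e z‖ ^ 2 + β * (‖z - q‖ ^ 2)⁻¹) (closure V) :=
    (hc.norm.pow 2).add (continuousOn_const.mul
      (ContinuousOn.inv₀ (by fun_prop) hne))
  obtain ⟨y, hy, hmax⟩ := hb.isCompact_closure.exists_isMaxOn ⟨x, subset_closure hx⟩ hcont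
  refine (hmax (subset_closure hx)).trans ?_
  by_cases hyV : y ∈ V
  swap
  · exact hfr y ⟨hy, fun h => hyV (interior_subset h)⟩
  exfalso
  have hloc : IsLocalMax (fun z => ‖e z‖ ^ 2 + β * (‖z - q‖ ^ 2)⁻¹) y :=
    hmax.isLocalMax (mem_of_superset (hV.mem_nhds hyV) subset_closure)
  have hqV : q ∉ V := fun h => hq (subset_closure h)
  have h0 := second_deriv_line_nonpos hV he hqV hyV hloc (EuclideanSpace.single 0 1)
  have h1 := second_deriv_line_nonpos hV he hqV hyV hloc (EuclideanSpace.single 1 1)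
  have hlap := hpde y hyV
  rw [laplacian_eq_fderiv_fderiv] at hlap
  -- the zeroth-order term drops out because multiplication by `iω` is skew-symmetric
  have hzero : inner ℝ (e y) (fderiv ℝ (fderiv ℝ e) y (EuclideanSpace.single 0 1)
      (EuclideanSpace.single 0 1)) + inner ℝ (e y) (fderiv ℝ (fderiv ℝ e) y
      (EuclideanSpace.single 1 1) (EuclideanSpace.single 1 1)) = 0 := by
    rw [← inner_add_right, hlap]
    simp [Complex.inner]
    ring
  have hg0 := real_inner_self_nonneg (x := fderiv ℝ e y (EuclideanSpace.single 0 1))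
  have hg1 := real_inner_self_nonneg (x := fderiv ℝ e y (EuclideanSpace.single 1 1))
  have hN := hne y hy
  have hsum : inner ℝ (y - q) (EuclideanSpace.single 0 1) ^ 2 +
      inner ℝ (y - q) (EuclideanSpace.single 1 1) ^ 2 = ‖y - q‖ ^ 2 := by
    rw [EuclideanSpace.norm_sq_eq]
    simp [EuclideanSpace.inner_single_right, Fin.sum_univ_two]
  set N := ‖y - q‖ ^ 2
  have hNpos : 0 < N := lt_of_le_of_ne (by positivity) (Ne.symm hN)
  have hkey : 8 * inner ℝ (y - q) (EuclideanSpace.single 0 1) ^ 2 / N ^ 3 - 2 / N ^ 2 +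
      (8 * inner ℝ (y - q) (EuclideanSpace.single 1 1) ^ 2 / N ^ 3 - 2 / N ^ 2) = 4 / N ^ 2 := by
    have : 8 * inner ℝ (y - q) (EuclideanSpace.single 0 1) ^ 2 / N ^ 3 +
      8 * inner ℝ (y - q) (EuclideanSpace.single 1 1) ^ 2 / N ^ 3 = 8 * N / N ^ 3 := by
      rw [← add_div, ← mul_add, hsum]
    have h8 : 8 * N / N ^ 3 = 8 / N ^ 2 := by field_simp
    rw [h8] at this
    linear_combination this
  have hpos : 0 < β * (4 / N ^ 2) := by positivity
  rw [← hkey] at hpos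
  simp only [PiLp.norm_single, norm_one, one_pow, mul_one] at h0 h1
  linarith

/-! ### Circle means -/

/-- Differentiation under an integral over a compact interval of a function that is continuous and
has a continuous partial derivative. -/
lemma hasDerivAt_intervalIntegral_of_continuousOn {F F' : ℝ → ℝ → ℂ} {R T : ℝ}
    (hF : ContinuousOn (Function.uncurry F) (Ioo (-R) R ×ˢ univ))
    (hF' : ContinuousOn (Function.uncurry F') (Ioo (-R) R ×ˢ univ))
    (h : ∀ r ∈ Ioo (-R) R, ∀ θ, HasDerivAt (fun r => F r θ) (F' r θ) r)
    {r : ℝ} (hr : r ∈ Ioo (-R) R) :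
    HasDerivAt (fun r => ∫ θ in (0 : ℝ)..T, F r θ) (∫ θ in (0 : ℝ)..T, F' r θ) r := by
  have hsec : ∀ {G : ℝ → ℝ → ℂ}, ContinuousOn (Function.uncurry G) (Ioo (-R) R ×ˢ univ) →
      ∀ s ∈ Ioo (-R) R, Continuous (G s) := by
    intro G hG s hs
    exact hG.comp_continuous (f := fun θ : ℝ => (s, θ)) (by fun_prop) (fun θ => ⟨hs, mem_univ _⟩)
  obtain ⟨ε, hε, hball⟩ := Metric.nhds_basis_closedBall.mem_iff.1 (isOpen_Ioo.mem_nhds hr)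
  obtain ⟨B, hB⟩ := ((isCompact_closedBall r ε).prod (isCompact_uIcc (a := (0 : ℝ)) (b := T))
    ).exists_bound_of_continuousOn (hF'.mono (prod_mono hball (subset_univ _)))
  refine (intervalIntegral.hasDerivAt_integral_of_dominated_loc_of_deriv_le
    (bound := fun _ => B) (Metric.closedBall_mem_nhds r hε) ?_ ?_ ?_ ?_ ?_ ?_).2
  · filter_upwards [isOpen_Ioo.mem_nhds hr] with s hs
    exact (hsec hF s hs).aestronglyMeasurable
  · exact (hsec hF r hr).intervalIntegrable _ _
  · exact (hsec hF' r hr).aestronglyMeasurable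
  · refine Eventually.of_forall fun θ hθ s hs => hB (s, θ) ⟨hs, uIoc_subset_uIcc hθ⟩
  · exact intervalIntegrable_const
  · exact Eventually.of_forall fun θ _ s hs => h s (hball hs) θ

/-- A solution of the Bessel-type equation `(s m')' = iω s m` that is regular at `0` agrees with
its second Picard iterate `(1 + iωr²/4) m(0)` up to a remainder of order `r⁴`.
Here `q` stands for `m'`. -/
lemma norm_bessel_sub_le {m q : ℝ → ℂ} {ω r M : ℝ} (hr : 0 ≤ r)
    (hm : ∀ s ∈ Icc 0 r, HasDerivAt m (q s) s) (hq0 : q 0 = 0)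
    (hp : ∀ s ∈ Icc 0 r, HasDerivAt (fun s : ℝ => (s : ℂ) * q s) (Complex.I * ω * s * m s) s)
    (hM : ∀ s ∈ Icc 0 r, ‖m s‖ ≤ M) :
    ‖m r - m 0 * (1 + Complex.I * ω * r ^ 2 / 4)‖ ≤ ω ^ 2 * M * r ^ 4 / 64 := by
  have hmc : ContinuousOn m (Icc 0 r) := fun s hs => (hm s hs).continuousAt.continuousWithinAt
  have hpc : ContinuousOn (fun s : ℝ => (s : ℂ) * q s) (Icc 0 r) :=
    fun s hs => (hp s hs).continuousAt.continuousWithinAt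
  have hmono : ∀ (c : ℂ) (s : ℝ), HasDerivAt (fun s : ℝ => c * (s : ℂ) ^ 2) (c * (2 * s)) s := by
    intro c s
    simpa using ((Complex.ofRealCLM.hasDerivAt (x := s)).pow 2).const_mul c
  have hmonoR : ∀ (n : ℕ) (c s : ℝ),
      HasDerivAt (fun s : ℝ => c * s ^ n) (c * (n * s ^ (n - 1))) s :=
    fun n c s => (hasDerivAt_pow n s).const_mul c
  -- division by `s`, with the value `q 0 = 0` covering the degenerate point
  have hq_of_p : ∀ (c : ℂ) (K : ℝ) (n : ℕ) (s : ℝ), 0 ≤ s →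
      ‖(s : ℂ) * q s - c * (s : ℂ) ^ 2‖ ≤ K * s ^ (n + 2) → ‖q s - c * s‖ ≤ K * s ^ (n + 1) := by
    intro c K n s hs h
    rcases hs.eq_or_lt with rfl | hs
    · simp [hq0]
    · have e1 : (s : ℂ) * q s - c * (s : ℂ) ^ 2 = s * (q s - c * s) := by ring
      rw [e1, norm_mul, Complex.norm_real, Real.norm_of_nonneg hs.le] at h
      have : s * ‖q s - c * s‖ ≤ s * (K * s ^ (n + 1)) := by
        calc _ ≤ _ := h
          _ = _ := by ring
      exact le_of_mul_le_mul_left this hs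
  have hnI : ∀ s ∈ Icc 0 r, ∀ z : ℂ, ‖Complex.I * ω * s * z‖ = |ω| * s * ‖z‖ := by
    intro s hs z
    simp [abs_of_nonneg hs.1]
  -- each pair of integrations improves the preceding bound by an order `s²`
  have hp1 : ∀ s ∈ Icc 0 r, ‖(s : ℂ) * q s - 0 * (s : ℂ) ^ 2‖ ≤ (|ω| * M / 2) * s ^ (0 + 2) := by
    refine image_norm_le_of_norm_deriv_right_le_deriv_boundary (B := fun s => (|ω| * M / 2) * s ^ 2)
      (f' := fun s => Complex.I * ω * s * m s) (by simpa using hpc) ?_ (by simp)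
      (hmonoR 2 _) ?_
    · intro s hs
      simpa using (hp s (Ico_subset_Icc_self hs)).hasDerivWithinAt
    · intro s hs
      have hs' := Ico_subset_Icc_self hs
      rw [hnI s hs']
      have : |ω| * s * ‖m s‖ ≤ |ω| * s * M :=
        mul_le_mul_of_nonneg_left (hM s hs') (mul_nonneg (abs_nonneg _) hs'.1)
      norm_num
      linarith
  have hm1 : ∀ s ∈ Icc 0 r, ‖m s - m 0‖ ≤ (|ω| * M / 4) * s ^ 2 := by
    refine image_norm_le_of_norm_deriv_right_le_deriv_boundary (f' := q)
      (B := fun s => (|ω| * M / 4) * s ^ 2) (hmc.sub continuousOn_const) ?_ (by simp)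
      (hmonoR 2 _) ?_
    · intro s hs
      exact ((hm s (Ico_subset_Icc_self hs)).sub_const _).hasDerivWithinAt
    · intro s hs
      have := hq_of_p 0 _ 0 s hs.1 (hp1 s (Ico_subset_Icc_self hs))
      norm_num at this ⊢
      linarith
  have hp2 : ∀ s ∈ Icc 0 r, ‖(s : ℂ) * q s - (Complex.I * ω * m 0 / 2) * (s : ℂ) ^ 2‖ ≤
      (ω ^ 2 * M / 16) * s ^ (2 + 2) := by
    refine image_norm_le_of_norm_deriv_right_le_deriv_boundary
      (B := fun s => (ω ^ 2 * M / 16) * s ^ 4)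
      (f' := fun s => Complex.I * ω * s * (m s - m 0))
      (hpc.sub (by fun_prop)) ?_ (by simp) (hmonoR 4 _) ?_
    · intro s hs
      have := (hp s (Ico_subset_Icc_self hs)).sub (hmono (Complex.I * ω * m 0 / 2) s)
      refine HasDerivAt.hasDerivWithinAt ?_
      convert this using 1
      ring
    · intro s hs
      have hs' := Ico_subset_Icc_self hs
      rw [hnI s hs']
      have : |ω| * s * ‖m s - m 0‖ ≤ |ω| * s * ((|ω| * M / 4) * s ^ 2) :=
        mul_le_mul_of_nonneg_left (hm1 s hs') (mul_nonneg (abs_nonneg _) hs'.1)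
      have e1 : |ω| * s * ((|ω| * M / 4) * s ^ 2) = ω ^ 2 * M / 4 * s ^ 3 := by
        rw [← sq_abs ω]; ring
      norm_num
      linarith
  have hm2 : ∀ s ∈ Icc 0 r, ‖m s - m 0 - (Complex.I * ω * m 0 / 4) * (s : ℂ) ^ 2‖ ≤
      (ω ^ 2 * M / 64) * s ^ 4 := by
    refine image_norm_le_of_norm_deriv_right_le_deriv_boundary
      (B := fun s => (ω ^ 2 * M / 64) * s ^ 4)
      (f' := fun s => q s - (Complex.I * ω * m 0 / 2) * s)
      ((hmc.sub continuousOn_const).sub (by fun_prop)) ?_ (by simp) (hmonoR 4 _) ?_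
    · intro s hs
      have := ((hm s (Ico_subset_Icc_self hs)).sub_const (m 0)).sub
        (hmono (Complex.I * ω * m 0 / 4) s)
      refine HasDerivAt.hasDerivWithinAt ?_
      refine this.congr_deriv ?_
      ring
    · intro s hs
      have := hq_of_p _ _ 2 s hs.1 (hp2 s (Ico_subset_Icc_self hs))
      norm_num at this ⊢
      linarith
  have := hm2 r ⟨hr, le_rfl⟩
  calc _ = ‖m r - m 0 - (Complex.I * ω * m 0 / 4) * (r : ℂ) ^ 2‖ := by congr 1; ring
    _ ≤ _ := this
    _ = _ := by ring

/-- The unit vector at angle `θ`, normal to the circles around the origin. -/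
noncomputable def radial (θ : ℝ) : Plane :=
  Real.cos θ • EuclideanSpace.single 0 1 + Real.sin θ • EuclideanSpace.single 1 1

/-- The unit tangent vector to the circles around the origin at angle `θ`. -/
noncomputable def tangential (θ : ℝ) : Plane :=
  (-Real.sin θ) • EuclideanSpace.single 0 1 + Real.cos θ • EuclideanSpace.single 1 1

lemma hasDerivAt_radial (θ : ℝ) : HasDerivAt radial (tangential θ) θ :=
  ((Real.hasDerivAt_cos θ).smul_const _).add ((Real.hasDerivAt_sin θ).smul_const _)

lemma hasDerivAt_tangential (θ : ℝ) : HasDerivAt tangential (-radial θ) θ := by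
  have := ((Real.hasDerivAt_sin θ).neg.smul_const (EuclideanSpace.single 0 1 : Plane)).add
    ((Real.hasDerivAt_cos θ).smul_const (EuclideanSpace.single 1 1 : Plane))
  refine this.congr_deriv ?_
  simp only [radial, neg_add, neg_smul]

lemma norm_radial (θ : ℝ) : ‖radial θ‖ = 1 := by
  rw [EuclideanSpace.norm_eq]
  simp [radial, Fin.sum_univ_two]

lemma continuous_radial : Continuous radial :=
  continuous_iff_continuousAt.2 fun θ => (hasDerivAt_radial θ).continuousAt

lemma continuous_tangential : Continuous tangential :=
  continuous_iff_continuousAt.2 fun θ => (hasDerivAt_tangential θ).continuousAt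

/-- The trace of a bilinear form can be computed in the rotated frame. -/
lemma bilinear_radial_add_tangential (B : Plane →L[ℝ] Plane →L[ℝ] ℂ) (θ : ℝ) :
    B (radial θ) (radial θ) + B (tangential θ) (tangential θ) =
      B (EuclideanSpace.single 0 1) (EuclideanSpace.single 0 1) +
      B (EuclideanSpace.single 1 1) (EuclideanSpace.single 1 1) := by
  have h : (Real.cos θ : ℂ) ^ 2 + (Real.sin θ : ℂ) ^ 2 = 1 := by
    exact_mod_cast Real.cos_sq_add_sin_sq θ
  simp only [radial, tangential, map_add, map_smul, add_apply,
    smul_apply, Complex.real_smul, Complex.ofReal_neg]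
  linear_combination (B (EuclideanSpace.single 0 1) (EuclideanSpace.single 0 1) +
      B (EuclideanSpace.single 1 1) (EuclideanSpace.single 1 1)) * h

lemma add_smul_radial_mem {x : Plane} {R s : ℝ} (hs : s ∈ Ioo (-R) R) (θ : ℝ) :
    x + s • radial θ ∈ ball x R := by
  simpa [norm_smul, norm_radial, abs_lt] using hs

lemma continuousOn_polar {α : Type*} [TopologicalSpace α] {G : Plane → α} {x : Plane} {R : ℝ}
    (hG : ContinuousOn G (ball x R)) :
    ContinuousOn (fun p : ℝ × ℝ => G (x + p.1 • radial p.2)) (Ioo (-R) R ×ˢ univ) := by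
  have hΦ : Continuous fun p : ℝ × ℝ => x + p.1 • radial p.2 :=
    continuous_const.add (continuous_fst.smul (continuous_radial.comp continuous_snd))
  exact hG.comp hΦ.continuousOn fun p hp => add_smul_radial_mem hp.1 p.2

lemma continuous_circle {α : Type*} [TopologicalSpace α] {G : Plane → α} {x : Plane} {R s : ℝ}
    (hG : ContinuousOn G (ball x R)) (hs : s ∈ Ioo (-R) R) :
    Continuous fun θ => G (x + s • radial θ) :=
  (continuousOn_polar hG).comp_continuous (f := fun θ : ℝ => (s, θ)) (by fun_prop)
    fun _ => ⟨hs, mem_univ _⟩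

lemma continuousOn_fderiv_fderiv {U : Set Plane} (hU : IsOpen U) {e : Plane → ℂ}
    (he : ContDiffOn ℝ 2 e U) : ContinuousOn (fderiv ℝ (fderiv ℝ e)) U :=
  (contDiffOn_fderiv hU he).continuousOn_fderiv_of_isOpen hU (by norm_num)

/-- The integral of `e` over the circle of radius `s` around `x` with respect to the angle,
that is, `2π` times the mean of `e`. Negative `s` are allowed, so that `s = 0` is an interior point
of the domain. -/
noncomputable def circleInt (e : Plane → ℂ) (x : Plane) (s : ℝ) : ℂ :=
  ∫ θ in (0 : ℝ)..2 * Real.pi, e (x + s • radial θ)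

/-- The integral of the radial derivative of `e` over the circle of radius `s` around `x` with
respect to the angle. -/
noncomputable def circleFlux (e : Plane → ℂ) (x : Plane) (s : ℝ) : ℂ :=
  ∫ θ in (0 : ℝ)..2 * Real.pi, fderiv ℝ e (x + s • radial θ) (radial θ)

lemma hasDerivAt_circleInt {e : Plane → ℂ} {R s : ℝ} {x : Plane}
    (he : ContDiffOn ℝ 2 e (ball x R)) (hs : s ∈ Ioo (-R) R) :
    HasDerivAt (circleInt e x) (circleFlux e x s) s := by
  have hcr : Continuous fun p : ℝ × ℝ => radial p.2 := continuous_radial.comp continuous_snd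
  exact hasDerivAt_intervalIntegral_of_continuousOn (F := fun s θ => e (x + s • radial θ))
    (F' := fun s θ => fderiv ℝ e (x + s • radial θ) (radial θ))
    (continuousOn_polar he.continuousOn)
    ((continuousOn_polar (contDiffOn_fderiv isOpen_ball he).continuousOn).clm_apply
      hcr.continuousOn)
    (fun s hs θ => (hasFDerivAt_of_contDiffOn isOpen_ball he
      (add_smul_radial_mem hs θ)).comp_hasDerivAt s (hasDerivAt_line x (radial θ) s)) hs

lemma hasDerivAt_circleFlux {e : Plane → ℂ} {R s : ℝ} {x : Plane}
    (he : ContDiffOn ℝ 2 e (ball x R)) (hs : s ∈ Ioo (-R) R) :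
    HasDerivAt (circleFlux e x) (∫ θ in (0 : ℝ)..2 * Real.pi,
      fderiv ℝ (fderiv ℝ e) (x + s • radial θ) (radial θ) (radial θ)) s := by
  have hcr : Continuous fun p : ℝ × ℝ => radial p.2 := continuous_radial.comp continuous_snd
  refine hasDerivAt_intervalIntegral_of_continuousOn
    (F := fun s θ => fderiv ℝ e (x + s • radial θ) (radial θ))
    (F' := fun s θ => fderiv ℝ (fderiv ℝ e) (x + s • radial θ) (radial θ) (radial θ))
    ((continuousOn_polar (contDiffOn_fderiv isOpen_ball he).continuousOn).clm_apply
      hcr.continuousOn)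
    (((continuousOn_polar (continuousOn_fderiv_fderiv isOpen_ball he)).clm_apply
      hcr.continuousOn).clm_apply hcr.continuousOn)
    (fun s hs θ => ?_) hs
  have := hasDerivAt_fderiv_comp isOpen_ball he (hasDerivAt_line x (radial θ) s)
      (hasDerivAt_const s (radial θ)) (add_smul_radial_mem hs θ)
  simpa using this

/-- The integrand is the derivative with respect to the angle of the tangential derivative of `e`,
which is periodic. -/
lemma integral_tangential_eq_zero {e : Plane → ℂ} {R s : ℝ} {x : Plane}
    (he : ContDiffOn ℝ 2 e (ball x R)) (hs : s ∈ Ioo (-R) R) :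
    ∫ θ in (0 : ℝ)..2 * Real.pi,
      (s * fderiv ℝ (fderiv ℝ e) (x + s • radial θ) (tangential θ) (tangential θ) -
        fderiv ℝ e (x + s • radial θ) (radial θ)) = 0 := by
  have h2 := continuous_circle (continuousOn_fderiv_fderiv isOpen_ball he) hs
  have h1 := continuous_circle (contDiffOn_fderiv isOpen_ball he).continuousOn hs
  rw [intervalIntegral.integral_eq_sub_of_hasDerivAt
    (f := fun θ => fderiv ℝ e (x + s • radial θ) (tangential θ))]
  · simp [radial, tangential]
  · intro θ _
    have hline : HasDerivAt (fun θ => x + s • radial θ) (s • tangential θ) θ :=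
      ((hasDerivAt_radial θ).const_smul s).const_add x
    have := hasDerivAt_fderiv_comp isOpen_ball he hline (hasDerivAt_tangential θ)
      (add_smul_radial_mem hs θ)
    refine this.congr_deriv ?_
    simp [sub_eq_add_neg]
  · apply Continuous.intervalIntegrable
    exact (continuous_const.mul ((h2.clm_apply continuous_tangential).clm_apply
      continuous_tangential)).sub (h1.clm_apply continuous_radial)

/-- The circle means of a solution of `Δe = iωe` solve `(s m')' = iω s m`. -/
lemma hasDerivAt_mul_circleFlux {e : Plane → ℂ} {ω R s : ℝ} {x : Plane}
    (he : ContDiffOn ℝ 2 e (ball x R))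
    (hpde : ∀ y ∈ ball x R, Laplacian.laplacian e y = Complex.I * ω * e y)
    (hs : s ∈ Ioo (-R) R) :
    HasDerivAt (fun s : ℝ => (s : ℂ) * circleFlux e x s)
      (Complex.I * ω * s * circleInt e x s) s := by
  have h2 := continuous_circle (continuousOn_fderiv_fderiv isOpen_ball he) hs
  have h1 := continuous_circle (contDiffOn_fderiv isOpen_ball he).continuousOn hs
  have h := (Complex.ofRealCLM.hasDerivAt (x := s)).mul (hasDerivAt_circleFlux he hs)
  simp only [Complex.ofRealCLM_apply, Complex.ofReal_one, one_mul] at h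
  refine h.congr_deriv ?_
  rw [← add_zero (_ + _), ← integral_tangential_eq_zero he hs, circleFlux, circleInt,
    ← intervalIntegral.integral_const_mul, ← intervalIntegral.integral_const_mul,
    ← intervalIntegral.integral_add, ← intervalIntegral.integral_add]
  · congr 1
    funext θ
    -- the tangential second derivative and the zero integral combine to the Laplacian
    have hl := hpde _ (add_smul_radial_mem hs θ)
    rw [laplacian_eq_fderiv_fderiv, ← bilinear_radial_add_tangential _ θ] at hl
    linear_combination (s : ℂ) * hl
  all_goals apply Continuous.intervalIntegrable
  · exact (h1.clm_apply continuous_radial).add (continuous_const.mul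
      ((h2.clm_apply continuous_radial).clm_apply continuous_radial))
  · exact (continuous_const.mul ((h2.clm_apply continuous_tangential).clm_apply
      continuous_tangential)).sub (h1.clm_apply continuous_radial)
  · exact h1.clm_apply continuous_radial
  · exact continuous_const.mul
      ((h2.clm_apply continuous_radial).clm_apply continuous_radial)

/-- The approximate mean value formula: the circle mean is `(1 + iωr²/4) e(x)` up to `O(r⁴)`, and
it is bounded by `M`. -/
theorem circle_mean_estimate {e : Plane → ℂ} {ω R M : ℝ} {x : Plane}
    (he : ContDiffOn ℝ 2 e (ball x R))
    (hpde : ∀ y ∈ ball x R, Laplacian.laplacian e y = Complex.I * ω * e y)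
    (hM : ∀ y ∈ ball x R, ‖e y‖ ≤ M) {r : ℝ} (hr : r ∈ Ico 0 R) :
    ‖e x‖ * ‖1 + Complex.I * ω * r ^ 2 / 4‖ ≤ M * (1 + ω ^ 2 * r ^ 4 / 64) := by
  have hR : 0 < R := hr.1.trans_lt hr.2
  have hsub : Icc 0 r ⊆ Ioo (-R) R := fun s hs => ⟨by linarith [hs.1], hs.2.trans_lt hr.2⟩
  have hTpos : 0 < 2 * Real.pi := by positivity
  have hbound : ∀ s ∈ Icc 0 r, ‖circleInt e x s‖ ≤ M * (2 * Real.pi) := by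
    intro s hs
    have := intervalIntegral.norm_integral_le_of_norm_le_const (a := 0) (b := 2 * Real.pi)
      (f := fun θ => e (x + s • radial θ)) (C := M)
      (fun θ _ => hM _ (add_smul_radial_mem (hsub hs) θ))
    rwa [sub_zero, abs_of_pos hTpos] at this
  have key := norm_bessel_sub_le hr.1 (fun s hs => hasDerivAt_circleInt he (hsub hs))
    (by
      have := integral_tangential_eq_zero (s := 0) he ⟨by linarith, hR⟩
      simp only [Complex.ofReal_zero, zero_mul, zero_sub] at this
      rw [intervalIntegral.integral_neg, neg_eq_zero] at this
      exact this)
    (fun s hs => hasDerivAt_mul_circleFlux he hpde (hsub hs)) hbound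
  have hm0 : circleInt e x 0 = (2 * Real.pi : ℝ) * e x := by simp [circleInt]
  rw [hm0] at key
  have hr' := hbound r ⟨hr.1, le_rfl⟩
  have h3 := norm_sub_norm_le ((2 * Real.pi : ℝ) * e x * (1 + Complex.I * ω * r ^ 2 / 4))
    (circleInt e x r)
  rw [norm_sub_rev, norm_mul, norm_mul, Complex.norm_real, Real.norm_of_nonneg hTpos.le] at h3
  refine le_of_mul_le_mul_left ?_ hTpos
  linarith

/-- Contraction at the centre of a ball. The factor is `(1 + t²/4) / √(1 + t²)`, where
`t = |ω|r²/4` for a radius `r < R` so small that `t ≤ 1`. -/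
theorem exists_interior_factor {ω : ℝ} (hω : ω ≠ 0) {R : ℝ} (hR : 0 < R) :
    ∃ γ : ℝ≥0, γ < 1 ∧ ∀ (e : Plane → ℂ) (x : Plane) (M : ℝ), ContDiffOn ℝ 2 e (ball x R) →
      (∀ y ∈ ball x R, Laplacian.laplacian e y = Complex.I * ω * e y) →
      (∀ y ∈ ball x R, ‖e y‖ ≤ M) → ‖e x‖ ≤ γ * M := by
  obtain ⟨r, hr0, hrR, hr1⟩ : ∃ r : ℝ, 0 < r ∧ r < R ∧ |ω| * r ^ 2 / 4 ≤ 1 := by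
    have hω' := abs_pos.2 hω
    have hc : Tendsto (fun r : ℝ => |ω| * r ^ 2 / 4) (𝓝[>] 0) (𝓝 0) := by
      have : Continuous fun r : ℝ => |ω| * r ^ 2 / 4 := by fun_prop
      simpa using (this.tendsto 0).mono_left nhdsWithin_le_nhds
    obtain ⟨r, hr⟩ := ((hc.eventually_le_const one_pos).and
      (Ioo_mem_nhdsGT hR : ∀ᶠ r in 𝓝[>] (0 : ℝ), r ∈ Ioo 0 R)).exists
    exact ⟨r, hr.2.1, hr.2.2, hr.1⟩
  set t := |ω| * r ^ 2 / 4 with ht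
  have htpos : 0 < t := by have := abs_pos.2 hω; positivity
  have hn : ‖1 + Complex.I * ω * r ^ 2 / 4‖ = √(1 + t ^ 2) := by
    have : (1 + Complex.I * ω * r ^ 2 / 4 : ℂ) = ⟨1, ω * r ^ 2 / 4⟩ := by
      apply Complex.ext <;> simp [pow_two]
    rw [this, Complex.norm_eq_sqrt_sq_add_sq]
    congr 1
    rw [ht]
    simp only [div_pow, mul_pow, sq_abs]
    ring
  have hs : 0 < √(1 + t ^ 2) := by positivity
  refine ⟨Real.toNNReal ((1 + t ^ 2 / 4) / √(1 + t ^ 2)), ?_, ?_⟩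
  · rw [Real.toNNReal_lt_one, div_lt_one hs]
    apply Real.lt_sqrt_of_sq_lt
    nlinarith [mul_pos htpos htpos, mul_le_mul hr1 hr1 htpos.le zero_le_one,
      mul_nonneg (sq_nonneg t) (sub_nonneg.2 (pow_le_one₀ (n := 2) htpos.le hr1))]
  · intro e x M he hpde hM
    have := circle_mean_estimate he hpde hM ⟨hr0.le, hrR⟩
    rw [hn] at this
    rw [Real.coe_toNNReal _ (by positivity), div_mul_eq_mul_div, le_div_iff₀ hs]
    calc _ ≤ _ := this
      _ = _ := by rw [ht]; simp only [div_pow, mul_pow, sq_abs]; ring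

/-! ### Bounds for solutions vanishing on the outer boundary -/

lemma mem_interface_or_mem_frontier {Ω U : Set Plane} (hΩ : IsOpen Ω) (hU : U ⊆ Ω) {y : Plane}
    (hy : y ∈ frontier U) : y ∈ interface Ω U ∨ y ∈ closure U ∩ frontier Ω := by
  by_cases h : y ∈ Ω
  · exact Or.inl ⟨hy, h⟩
  · refine Or.inr ⟨hy.1, closure_mono hU hy.1, ?_⟩
    rwa [hΩ.interior_eq]

lemma SolvesIn.laplacian_eq {ω : ℝ} {U : Set Plane} {e : Plane → ℂ} (he : SolvesIn ω 0 U e)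
    {x : Plane} (hx : x ∈ U) : Laplacian.laplacian e x = Complex.I * ω * e x :=
  sub_eq_zero.1 (he.2 x hx)

/-- The maximum principle: a solution that vanishes on the outer boundary is bounded by its values
on the interface. -/
theorem SolvesLocal.norm_le {ω : ℝ} {Ω U : Set Plane} {e : Plane → ℂ} (hΩ : IsOpen Ω)
    (hb : Bornology.IsBounded Ω) (hU : IsOpen U) (hUΩ : U ⊆ Ω) (he : SolvesLocal ω 0 Ω U e)
    {M : ℝ} (hM0 : 0 ≤ M) (hM : ∀ y ∈ interface Ω U, ‖e y‖ ≤ M) {x : Plane}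
    (hx : x ∈ closure U) : ‖e x‖ ≤ M := by
  have hfr : ∀ y ∈ frontier U, ‖e y‖ ≤ M := by
    intro y hy
    rcases mem_interface_or_mem_frontier hΩ hUΩ hy with h | h
    · exact hM y h
    · rw [he.2 y h, norm_zero]; exact hM0
  by_cases hxU : x ∈ U
  swap
  · exact hfr x ⟨hx, fun h => hxU (interior_subset h)⟩
  obtain ⟨R, hR⟩ := ((hb.subset hUΩ).closure).exists_norm_le
  -- with `q` far away, the strictly subharmonic perturbation `ε|y - q|⁻²` is at most `ε`
  obtain ⟨q, hq⟩ := NormedSpace.exists_lt_norm ℝ Plane (R + 1)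
  have hdist : ∀ y ∈ closure U, 1 ≤ ‖y - q‖ ^ 2 := by
    intro y hy
    have h1 := norm_sub_norm_le q y
    rw [norm_sub_rev] at h1
    have h2 := hR y hy
    nlinarith
  have hqU : q ∉ closure U := fun h => by linarith [hR q h]
  refine le_of_sq_le_sq ?_ hM0
  refine le_of_forall_pos_le_add fun ε hε => ?_
  have := barrier_maximum_principle hU (hb.subset hUΩ) he.1.1.1 he.1.1.2
    (fun x hx => he.1.laplacian_eq hx) hqU hε (C := M ^ 2 + ε) (fun y hy => ?_) hxU
  · exact (le_add_of_nonneg_right (by positivity)).trans this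
  · have h1 : (‖y - q‖ ^ 2)⁻¹ ≤ 1 := inv_le_one_of_one_le₀ (hdist y hy.1)
    have h2 := pow_le_pow_left₀ (norm_nonneg _) (hfr y hy) 2
    nlinarith

/-- Comparison with an exterior barrier: `Ω` lies outside the ball of radius `s` around `q`, and the
disc of radius `R` around `q` does not meet the interface. The function
`M² (s⁻² - |y - q|⁻²) / (s⁻² - R⁻²)` is nonnegative on `∂Ω` and equals `M²` at distance `R` from
`q`, so it bounds `|e|²` in the disc. -/
theorem SolvesLocal.norm_sq_le_barrier {ω : ℝ} {Ω U : Set Plane} {e : Plane → ℂ} (hΩ : IsOpen Ω)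
    (hU : IsOpen U) (hUΩ : U ⊆ Ω) (he : SolvesLocal ω 0 Ω U e)
    {M : ℝ} (hM : ∀ y ∈ closure U, ‖e y‖ ≤ M) {q : Plane} {s r R : ℝ} (hs : 0 < s) (hsr : s < r)
    (hrR : r < R) (hext : ∀ y ∈ closure Ω, s ≤ dist y q)
    (hint : ∀ y ∈ interface Ω U, R < dist y q) {x : Plane} (hx : x ∈ U) (hxq : dist x q ≤ r) :
    ‖e x‖ ^ 2 ≤ ((s ^ 2)⁻¹ - (r ^ 2)⁻¹) / ((s ^ 2)⁻¹ - (R ^ 2)⁻¹) * M ^ 2 := by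
  have hr : 0 < r := hs.trans hsr
  have hR : 0 < R := hr.trans hrR
  have hinv : ∀ {a b : ℝ}, 0 < a → a ≤ b → (b ^ 2)⁻¹ ≤ (a ^ 2)⁻¹ := fun ha hab =>
    inv_anti₀ (by positivity) (pow_le_pow_left₀ ha.le hab 2)
  have hD : 0 < (s ^ 2)⁻¹ - (R ^ 2)⁻¹ :=
    sub_pos.2 (inv_strictAnti₀ (by positivity) (pow_lt_pow_left₀ (hsr.trans hrR) hs.le two_ne_zero))
  have hD' : 0 ≤ (s ^ 2)⁻¹ - (r ^ 2)⁻¹ := sub_nonneg.2 (hinv hs hsr.le)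
  have hMx := hM x (subset_closure hx)
  rcases ((norm_nonneg _).trans hMx).eq_or_lt with rfl | hMpos
  · have := norm_le_zero_iff.1 hMx
    simp [this]
  set β := M ^ 2 / ((s ^ 2)⁻¹ - (R ^ 2)⁻¹) with hβ
  have hβpos : 0 < β := by positivity
  have hβeq : β * ((s ^ 2)⁻¹ - (R ^ 2)⁻¹) = M ^ 2 := div_mul_cancel₀ _ hD.ne'
  have hcl : closure (U ∩ ball q R) ⊆ closure U := closure_mono inter_subset_left
  have hqc : q ∉ closure (U ∩ ball q R) := by
    intro h
    have := hext q (closure_mono hUΩ (hcl h))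
    rw [dist_self] at this
    linarith
  have key := barrier_maximum_principle (hU.inter isOpen_ball)
    (isBounded_ball.subset inter_subset_right) (he.1.1.1.mono inter_subset_left)
    (he.1.1.2.mono hcl) (fun x hx => he.1.laplacian_eq hx.1) hqc hβpos
    (C := β * (s ^ 2)⁻¹) ?_ (x := x) ⟨hx, by rw [mem_ball]; linarith⟩
  · have h1 : (r ^ 2)⁻¹ ≤ (‖x - q‖ ^ 2)⁻¹ := by
      rw [← dist_eq_norm]
      exact hinv (hs.trans_le (hext x (subset_closure (hUΩ hx)))) hxq
    have h2 := mul_le_mul_of_nonneg_left h1 hβpos.le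
    calc ‖e x‖ ^ 2 ≤ β * ((s ^ 2)⁻¹ - (r ^ 2)⁻¹) := by linarith
      _ = _ := by rw [hβ]; ring
  · intro y hy
    have hyU : y ∈ closure U := hcl hy.1
    have hsy := hext y (closure_mono hUΩ hyU)
    have hyR : dist y q ≤ R :=
      closure_ball_subset_closedBall (closure_mono inter_subset_right hy.1)
    rw [← dist_eq_norm]
    rcases hyR.lt_or_eq with h | h
    · have hyf : y ∈ frontier U := by
        refine ⟨hyU, fun hi => hy.2 ?_⟩
        rw [(hU.inter isOpen_ball).interior_eq]
        exact ⟨interior_subset hi, h⟩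
      have hy0 : e y = 0 := by
        rcases mem_interface_or_mem_frontier hΩ hUΩ hyf with h' | h'
        · exact absurd (hint y h') (not_lt.2 hyR)
        · exact he.2 y h'
      rw [hy0, norm_zero]
      simpa using mul_le_mul_of_nonneg_left (hinv hs hsy) hβpos.le
    · have := pow_le_pow_left₀ (norm_nonneg _) (hM y hyU) 2
      rw [h]
      linarith

/-- Points outside the closure of `Ω` are found by moving from `p` in a direction in which the
defining function increases. -/
lemma HasSmoothBoundary.exists_exterior_point {Ω : Set Plane} (hΩ : IsOpen Ω)
    (h : HasSmoothBoundary Ω) {p : Plane} (hp : p ∈ frontier Ω) {ε : ℝ} (hε : 0 < ε) :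
    ∃ q ∈ ball p ε, q ∉ closure Ω := by
  obtain ⟨V, ρ, hV, hpV, hρ, hD, hΩV⟩ := h p hp
  have hpΩ : p ∉ Ω := by
    have := hp.2
    rwa [hΩ.interior_eq] at this
  have hρp : 0 ≤ ρ p := by
    by_contra! hlt
    have : p ∈ Ω ∩ V := hΩV ▸ ⟨hpV, hlt⟩
    exact hpΩ this.1
  obtain ⟨v, hv⟩ : ∃ v, 0 < fderiv ℝ ρ p v := by
    by_contra! hle
    refine hD p hpV (ContinuousLinearMap.ext fun v => le_antisymm (hle v) ?_)
    have := hle (-v)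
    rw [map_neg] at this
    simpa using this
  have hdiff : HasFDerivAt ρ (fderiv ℝ ρ p) p :=
    ((hρ.contDiffAt (hV.mem_nhds hpV)).differentiableAt (by simp)).hasFDerivAt
  have hp0 : p + (0 : ℝ) • v = p := by simp
  have hline := hasDerivAt_line p v 0
  have hder : HasDerivAt (fun t : ℝ => ρ (p + t • v)) (fderiv ℝ ρ p v) 0 := by
    rw [← hp0] at hdiff
    have := hdiff.comp_hasDerivAt (0 : ℝ) hline
    rwa [hp0] at this
  have hslope : ∀ᶠ t in 𝓝[≠] (0 : ℝ), 0 < t⁻¹ • (ρ (p + (0 + t) • v) - ρ (p + (0 : ℝ) • v)) :=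
    (hasDerivAt_iff_tendsto_slope_zero.1 hder).eventually_const_lt hv
  have hcont : Tendsto (fun t : ℝ => p + t • v) (𝓝[>] 0) (𝓝 p) := by
    have := hline.continuousAt.tendsto
    rw [hp0] at this
    exact this.mono_left nhdsWithin_le_nhds
  have hle : 𝓝[>] (0 : ℝ) ≤ 𝓝[≠] 0 := nhdsWithin_mono _ fun t ht => ne_of_gt ht
  obtain ⟨t, ⟨⟨h1, h2⟩, h3⟩, h4⟩ := (((hslope.filter_mono hle).and
    (hcont.eventually (hV.mem_nhds hpV))).and
    (hcont.eventually (ball_mem_nhds p hε))).and self_mem_nhdsWithin |>.exists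
  have ht : (0 : ℝ) < t := h4
  refine ⟨p + t • v, h3, fun hcl => ?_⟩
  have hpos : 0 < ρ (p + t • v) := by
    simp only [zero_add, hp0, smul_eq_mul] at h1
    have := pos_of_mul_pos_right h1 (inv_pos.2 ht).le
    linarith
  have hopen : {x | 0 < ρ x} ∈ 𝓝 (p + t • v) :=
    (hρ.continuousOn.continuousAt (hV.mem_nhds h2)).eventually_const_lt hpos
  obtain ⟨z, ⟨hz1, hz2⟩, hz3⟩ := mem_closure_iff_nhds.1 hcl _ (inter_mem hopen (hV.mem_nhds h2))
  have : z ∈ {x ∈ V | ρ x < 0} := hΩV ▸ ⟨hz3, hz2⟩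
  exact lt_asymm hz1 this.2

/-! ### Contraction from the interface to the support -/

/-- The solutions in `U` that vanish on the outer boundary are contracted on `S`: there is a factor
`γ < 1`, independent of the solution, such that `|e| ≤ M` on the closure of `U` implies `|e| ≤ γM`
on `S`. -/
def HasFactorOn (ω : ℝ) (Ω U S : Set Plane) : Prop :=
  ∃ γ : ℝ≥0, γ < 1 ∧ ∀ (e : Plane → ℂ) (M : ℝ), SolvesLocal ω 0 Ω U e →
    (∀ y ∈ closure U, ‖e y‖ ≤ M) → ∀ x ∈ S, ‖e x‖ ≤ γ * M

lemma hasFactorOn_ball {ω : ℝ} (hω : ω ≠ 0) {Ω U : Set Plane} {p : Plane} {r : ℝ} (hr : 0 < r)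
    (hp : ball p (r + r) ⊆ U) : HasFactorOn ω Ω U (ball p r) := by
  obtain ⟨γ, hγ, h⟩ := exists_interior_factor hω hr
  refine ⟨γ, hγ, fun e M he hM x hx => ?_⟩
  have hsub : ball x r ⊆ U := (ball_subset_ball' (by
    have : dist x p < r := hx
    linarith)).trans hp
  exact h e x M (he.1.1.1.mono hsub) (fun y hy => he.1.laplacian_eq (hsub hy))
    fun y hy => hM y (subset_closure (hsub hy))

/-- Contraction near a point of the outer boundary. The radii `d/4 < d/2` of the discs around the
exterior point `q` are chosen so that the smaller disc contains all points at distance less than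
`d/8` from `p`, and the larger one stays away from the interface if there is such a point
in `K`. -/
lemma hasFactorOn_near_frontier {ω : ℝ} {Ω U K : Set Plane} (hΩ : IsOpen Ω)
    (hs : HasSmoothBoundary Ω) (hU : IsOpen U) (hUΩ : U ⊆ Ω) (hKU : K ⊆ U) {d : ℝ} (hd : 0 < d)
    (hK : ∀ x ∈ K, ∀ y ∈ interface Ω U, d ≤ dist x y) {p : Plane} (hp : p ∈ frontier Ω) :
    HasFactorOn ω Ω U (ball p (d / 8) ∩ K) := by
  obtain ⟨q, hqp, hq⟩ := hs.exists_exterior_point hΩ hp (ε := d / 8) (by positivity)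
  have hinf : 0 < infDist q (closure Ω) :=
    (isClosed_closure.notMem_iff_infDist_pos ⟨p, hp.1⟩).1 hq
  set s := min (infDist q (closure Ω)) (d / 8) with hsdef
  have hs0 : 0 < s := lt_min hinf (by positivity)
  have hsd : s ≤ d / 8 := min_le_right _ _
  have hsr : s < d / 4 := by linarith
  have hrR : d / 4 < d / 2 := by linarith
  have hlt : ∀ {a b : ℝ}, 0 < a → a < b → (b ^ 2)⁻¹ < (a ^ 2)⁻¹ := fun ha hab =>
    inv_strictAnti₀ (by positivity) (pow_lt_pow_left₀ hab ha.le two_ne_zero)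
  have h1 := hlt hs0 hsr
  have h2 := hlt (by positivity) hrR
  set g := ((s ^ 2)⁻¹ - ((d / 4) ^ 2)⁻¹) / ((s ^ 2)⁻¹ - ((d / 2) ^ 2)⁻¹) with hg
  have hg0 : 0 ≤ g := div_nonneg (by linarith) (by linarith)
  refine ⟨Real.toNNReal √g, ?_, fun e M he hM x hx => ?_⟩
  · rw [Real.toNNReal_lt_one, Real.sqrt_lt' one_pos, one_pow, hg, div_lt_one (by linarith)]
    linarith
  · have hxq : dist x q < d / 4 := by
      have ha : dist x p < d / 8 := hx.1
      have hb : dist q p < d / 8 := hqp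
      linarith [dist_triangle_right x q p]
    have key := he.norm_sq_le_barrier hΩ hU hUΩ hM hs0 hsr hrR (q := q)
      (fun y hy => (min_le_left _ _).trans (by
        rw [dist_comm]; exact infDist_le_dist_of_mem hy))
      (fun y hy => by linarith [hK x hx.2 y hy, dist_triangle x q y, dist_comm y q])
      (hKU hx.2) hxq.le
    have hM0 : 0 ≤ M := (norm_nonneg _).trans (hM x (subset_closure (hKU hx.2)))
    rw [Real.coe_toNNReal _ (Real.sqrt_nonneg _)]
    refine le_of_sq_le_sq ?_ (by positivity)
    rwa [mul_pow, Real.sq_sqrt hg0]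

theorem hasFactorOn_of_dist_interface {ω : ℝ} (hω : ω ≠ 0) {Ω U K : Set Plane} (hΩ : IsOpen Ω)
    (hb : Bornology.IsBounded Ω) (hs : HasSmoothBoundary Ω) (hU : IsOpen U) (hUΩ : U ⊆ Ω)
    (hKU : K ⊆ U) (hKcl : closure K ∩ Ω ⊆ K) {d : ℝ} (hd : 0 < d)
    (hK : ∀ x ∈ K, ∀ y ∈ interface Ω U, d ≤ dist x y) : HasFactorOn ω Ω U K := by
  have hcomp : IsCompact (closure K) := (hb.subset (hKU.trans hUΩ)).isCompact_closure
  suffices h : HasFactorOn ω Ω U (closure K ∩ K) by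
    rwa [inter_eq_right.2 subset_closure] at h
  refine hcomp.induction_on (p := fun S => HasFactorOn ω Ω U (S ∩ K)) ?_ ?_ ?_ ?_
  · exact ⟨0, one_pos, by simp⟩
  · rintro S T hST ⟨γ, hγ, h⟩
    exact ⟨γ, hγ, fun e M he hM x hx => h e M he hM x ⟨hST hx.1, hx.2⟩⟩
  · rintro S T ⟨γ, hγ, h⟩ ⟨γ', hγ', h'⟩
    refine ⟨max γ γ', max_lt hγ hγ', fun e M he hM x hx => ?_⟩
    have hM0 : 0 ≤ M := (norm_nonneg _).trans (hM x (subset_closure (hKU hx.2)))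
    rcases hx with ⟨hx | hx, hxK⟩
    · exact (h e M he hM x ⟨hx, hxK⟩).trans
        (mul_le_mul_of_nonneg_right (NNReal.coe_le_coe.2 (le_max_left _ _)) hM0)
    · exact (h' e M he hM x ⟨hx, hxK⟩).trans
        (mul_le_mul_of_nonneg_right (NNReal.coe_le_coe.2 (le_max_right _ _)) hM0)
  · intro p hp
    by_cases hpΩ : p ∈ Ω
    · obtain ⟨r, hr, hball⟩ := Metric.isOpen_iff.1 hU p (hKU (hKcl ⟨hp, hpΩ⟩))
      obtain ⟨γ, hγ, h⟩ := hasFactorOn_ball hω (Ω := Ω) (U := U) (half_pos hr) (by rwa [add_halves])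
      exact ⟨ball p (r / 2), mem_nhdsWithin_of_mem_nhds (ball_mem_nhds p (half_pos hr)),
        γ, hγ, fun e M he hM x hx => h e M he hM x hx.1⟩
    · refine ⟨ball p (d / 8), mem_nhdsWithin_of_mem_nhds (ball_mem_nhds p (by positivity)),
        hasFactorOn_near_frontier hΩ hs hU hUΩ hKU hd hK ⟨?_, ?_⟩⟩
      · exact closure_mono (hKU.trans hUΩ) hp
      · rwa [hΩ.interior_eq]

/-! ### Supremum norms -/

lemma enorm_le_supNorm {S : Set Plane} (v : Plane → ℂ) {x : Plane} (hx : x ∈ S) :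
    ‖v x‖ₑ ≤ supNorm S v := le_iSup₂_of_le x hx le_rfl

lemma supNorm_le {S : Set Plane} {v : Plane → ℂ} {C : ℝ≥0∞} (h : ∀ x ∈ S, ‖v x‖ₑ ≤ C) :
    supNorm S v ≤ C := iSup₂_le h

lemma supNorm_mono {S T : Set Plane} (h : S ⊆ T) (v : Plane → ℂ) : supNorm S v ≤ supNorm T v :=
  supNorm_le fun _ hx => enorm_le_supNorm v (h hx)

lemma supNorm_congr {S : Set Plane} {v w : Plane → ℂ} (h : ∀ x ∈ S, v x = w x) :
    supNorm S v = supNorm S w := by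
  simp only [supNorm]
  exact iSup_congr fun x => iSup_congr fun hx => by rw [h x hx]

lemma norm_le_toReal_supNorm {S : Set Plane} {v : Plane → ℂ} (hfin : supNorm S v ≠ ∞)
    {x : Plane} (hx : x ∈ S) : ‖v x‖ ≤ (supNorm S v).toReal := by
  rw [← toReal_enorm]
  exact ENNReal.toReal_mono hfin (enorm_le_supNorm v hx)

lemma supNorm_le_mul {S : Set Plane} {v : Plane → ℂ} {γ : ℝ≥0} {b : ℝ≥0∞} (hb : b ≠ ∞)
    (h : ∀ x ∈ S, ‖v x‖ ≤ γ * b.toReal) : supNorm S v ≤ γ * b := by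
  refine supNorm_le fun x hx => ?_
  rw [← ofReal_norm, ← ENNReal.ofReal_toReal hb, ← ENNReal.ofReal_coe_nnreal,
    ← ENNReal.ofReal_mul γ.coe_nonneg]
  exact ENNReal.ofReal_le_ofReal (h x hx)

lemma supNorm_closure {U : Set Plane} {v : Plane → ℂ} (hv : ContinuousOn v (closure U)) :
    supNorm (closure U) v = supNorm U v := by
  refine le_antisymm (supNorm_le fun x hx => ?_) (supNorm_mono subset_closure v)
  have hc : ContinuousWithinAt (fun y => ‖v y‖ₑ) U x :=
    continuous_enorm.continuousAt.comp_continuousWithinAt ((hv x hx).mono subset_closure)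
  have := mem_closure_iff_nhdsWithin_neBot.1 hx
  exact le_of_tendsto hc (eventually_mem_nhdsWithin.mono fun y hy => enorm_le_supNorm v hy)

lemma supNorm_closure_ne_top {U : Set Plane} (hb : Bornology.IsBounded U) {v : Plane → ℂ}
    (hv : ContinuousOn v (closure U)) : supNorm (closure U) v ≠ ∞ := by
  obtain ⟨C, hC⟩ := hb.isCompact_closure.exists_bound_of_continuousOn hv
  refine ne_top_of_le_ne_top (ENNReal.ofReal_ne_top (r := C)) (supNorm_le fun x hx => ?_)
  rw [← ofReal_norm]
  exact ENNReal.ofReal_le_ofReal (hC x hx)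

lemma supNorm_interface_le {Ω U : Set Plane} {v : Plane → ℂ} (hv : ContinuousOn v (closure U)) :
    supNorm (interface Ω U) v ≤ supNorm U v := by
  rw [← supNorm_closure hv]
  exact supNorm_mono (inter_subset_left.trans frontier_subset_closure) v

lemma SolvesLocal.supNorm_le_interface {ω : ℝ} {Ω U : Set Plane} {e : Plane → ℂ} (hΩ : IsOpen Ω)
    (hb : Bornology.IsBounded Ω) (hU : IsOpen U) (hUΩ : U ⊆ Ω) (he : SolvesLocal ω 0 Ω U e) :
    supNorm U e ≤ supNorm (interface Ω U) e := by
  have hfin : supNorm (interface Ω U) e ≠ ∞ := ne_top_of_le_ne_top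
    (supNorm_closure_ne_top (hb.subset hUΩ) he.1.1.2)
    (supNorm_mono (inter_subset_left.trans frontier_subset_closure) e)
  have := supNorm_le_mul (γ := 1) (S := U) (v := e) hfin fun x hx => by
    simpa using he.norm_le hΩ hb hU hUΩ ENNReal.toReal_nonneg
      (fun y hy => norm_le_toReal_supNorm hfin hy) (subset_closure hx)
  simpa using this

lemma HasFactorOn.exists_supNorm_le {ω : ℝ} {Ω U K : Set Plane} (hΩ : IsOpen Ω)
    (hb : Bornology.IsBounded Ω) (hU : IsOpen U) (hUΩ : U ⊆ Ω) (h : HasFactorOn ω Ω U K) :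
    ∃ γ : ℝ≥0, γ < 1 ∧ ∀ e : Plane → ℂ, SolvesLocal ω 0 Ω U e →
      supNorm K e ≤ γ * supNorm (interface Ω U) e := by
  obtain ⟨γ, hγ, h⟩ := h
  refine ⟨γ, hγ, fun e he => ?_⟩
  have hfin : supNorm (interface Ω U) e ≠ ∞ := ne_top_of_le_ne_top
    (supNorm_closure_ne_top (hb.subset hUΩ) he.1.1.2)
    (supNorm_mono (inter_subset_left.trans frontier_subset_closure) e)
  exact supNorm_le_mul hfin (h e _ he fun y hy => he.norm_le hΩ hb hU hUΩ ENNReal.toReal_nonneg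
      (fun y hy => norm_le_toReal_supNorm hfin hy) hy)

/-! ### The errors of the Schwarz method -/

lemma SolvesLocal.sub_left_of_solvesGlobal {ω : ℝ} {f u w : Plane → ℂ} {Ω U : Set Plane}
    (hU : IsOpen U) (hUΩ : U ⊆ Ω) (hu : SolvesGlobal ω f Ω u) (hw : SolvesLocal ω f Ω U w) :
    SolvesLocal ω 0 Ω U (fun x => u x - w x) := by
  have hu2 := hu.1.1.1.mono hUΩ
  refine ⟨⟨⟨hu2.sub hw.1.1.1, (hu.1.1.2.mono (closure_mono hUΩ)).sub hw.1.1.2⟩, ?_⟩, ?_⟩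
  · intro x hx
    have hl : Laplacian.laplacian (fun x => u x - w x) x =
        Laplacian.laplacian u x - Laplacian.laplacian w x :=
      (hu2.contDiffAt (hU.mem_nhds hx)).laplacian_sub (hw.1.1.1.contDiffAt (hU.mem_nhds hx))
    rw [hl]
    simp only [Pi.zero_apply]
    linear_combination hu.1.2 x (hUΩ hx) - hw.1.2 x hx
  · intro x hx
    simp [hu.2 x hx.2, hw.2 x hx]

/-- The error of an assembled function is a convex combination of the local errors at points of the
supports of the cut-off functions. -/
lemma IsPartition.supNorm_sub_assembled_le {J : ℕ} {Ω : Set Plane} {Ωs : Fin J → Set Plane}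
    {χ : Fin J → Plane → ℝ} (hχ : IsPartition Ω Ωs χ) {u v : Plane → ℂ} {w : Fin J → Plane → ℂ}
    (hv : IsAssembled Ω χ w v) :
    supNorm Ω (fun x => u x - v x) ≤ ⨆ j, supNorm (supportIn Ω (χ j)) (fun x => u x - w j x) := by
  refine supNorm_le fun x hx => ?_
  have hsum : (∑ j, (χ j x : ℂ)) = 1 := by exact_mod_cast hχ.sum_eq_one x hx
  have hux : u x - v x = ∑ j, (χ j x : ℂ) * (u x - w j x) := by
    simp only [mul_sub, Finset.sum_sub_distrib, ← Finset.sum_mul, hsum, one_mul, hv x hx]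
  set B := ⨆ j, supNorm (supportIn Ω (χ j)) (fun x => u x - w j x)
  have hterm : ∀ j, ‖(χ j x : ℂ) * (u x - w j x)‖ₑ ≤ ENNReal.ofReal (χ j x) * B := by
    intro j
    by_cases h0 : χ j x = 0
    · simp [h0]
    · rw [enorm_mul, ← ofReal_norm (χ j x : ℂ), Complex.norm_real,
        Real.norm_of_nonneg (hχ.nonneg j x hx)]
      gcongr
      exact (enorm_le_supNorm (fun x => u x - w j x)
        (show x ∈ supportIn Ω (χ j) from ⟨subset_closure ⟨hx, h0⟩, hx⟩)).trans
        (le_iSup (fun j => supNorm (supportIn Ω (χ j)) fun x => u x - w j x) j)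
  calc ‖u x - v x‖ₑ ≤ ∑ j, ‖(χ j x : ℂ) * (u x - w j x)‖ₑ := by
        rw [hux]; exact enorm_sum_le _ _
    _ ≤ ∑ j, ENNReal.ofReal (χ j x) * B := Finset.sum_le_sum fun j _ => hterm j
    _ = B := by
        rw [← Finset.sum_mul, ← ENNReal.ofReal_sum_of_nonneg fun j _ => hχ.nonneg j x hx,
          hχ.sum_eq_one x hx, ENNReal.ofReal_one, one_mul]

end SchwarzMT

open SchwarzMT

theorem theorem4 {J : ℕ} (ω : ℝ) (hω : ω ≠ 0)
    (Ω : Set SchwarzMT.Plane) (hΩ : SchwarzMT.IsSmoothBoundedDomain Ω)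
    (Ωs : Fin J → Set SchwarzMT.Plane) (hΩs : SchwarzMT.StronglyOverlapping Ω Ωs)
    (χ : Fin J → SchwarzMT.Plane → ℝ) (hχ : SchwarzMT.IsPartition Ω Ωs χ) :
    ∃ γ : ℝ≥0, γ < 1 ∧
      -- `γ` is a contraction factor from the interfaces to the supports of the `χ j`
      (∀ (j : Fin J) (e : SchwarzMT.Plane → ℂ), SchwarzMT.SolvesLocal ω 0 Ω (Ωs j) e →
        SchwarzMT.supNorm (SchwarzMT.supportIn Ω (χ j)) e ≤
          (γ : ℝ≥0∞) * SchwarzMT.supNorm (SchwarzMT.interface Ω (Ωs j)) e) ∧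
      ∀ (f u : SchwarzMT.Plane → ℂ), ContDiffOn ℝ (⊤ : ℕ∞) f Ω → ContinuousOn f (closure Ω) →
        SchwarzMT.SolvesGlobal ω f Ω u →
        ∀ (uglob : ℕ → SchwarzMT.Plane → ℂ) (uloc : ℕ → Fin J → SchwarzMT.Plane → ℂ),
          SchwarzMT.IsSchwarz ω f Ω Ωs χ uglob uloc →
          -- convergence of the local and of the global approximations
          Filter.Tendsto (fun n => SchwarzMT.maxErr Ωs u (uloc n)) Filter.atTop (nhds 0) ∧
          Filter.Tendsto (fun n => SchwarzMT.supNorm Ω (fun x => u x - uglob n x))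
            Filter.atTop (nhds 0) ∧
          -- estimates for an arbitrary initial guess
          SchwarzMT.maxErr Ωs u (uloc 1) ≤ SchwarzMT.supNorm Ω (fun x => u x - uglob 0 x) ∧
          (∀ n, SchwarzMT.maxErr Ωs u (uloc (n + 1)) ≤
            (γ : ℝ≥0∞) ^ n * SchwarzMT.maxErr Ωs u (uloc 1)) ∧
          -- estimate from step `0`, for an initial guess assembled from local solutions `uloc 0 j`
          ((∀ j, SchwarzMT.SolvesLocal ω f Ω (Ωs j) (uloc 0 j)) →
            SchwarzMT.IsAssembled Ω χ (uloc 0) (uglob 0) →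
            ∀ n, SchwarzMT.maxErr Ωs u (uloc n) ≤
              (γ : ℝ≥0∞) ^ n * SchwarzMT.maxErr Ωs u (uloc 0)) := by
  have hO := hΩs.1
  have hfac : ∀ j, ∃ γ : ℝ≥0, γ < 1 ∧ ∀ e : Plane → ℂ, SolvesLocal ω 0 Ω (Ωs j) e →
      supNorm (supportIn Ω (χ j)) e ≤ γ * supNorm (interface Ω (Ωs j)) e := by
    intro j
    obtain ⟨d, hd, hdist⟩ := hχ.support_dist j
    refine (hasFactorOn_of_dist_interface hω hΩ.isOpen hΩ.isBounded hΩ.smooth (hO j).1 (hO j).2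
      (hχ.support_subset j) ?_ hd hdist).exists_supNorm_le hΩ.isOpen hΩ.isBounded (hO j).1 (hO j).2
    rintro x ⟨hx, hxΩ⟩
    exact ⟨closure_minimal Set.inter_subset_left isClosed_closure hx, hxΩ⟩
  choose g hg hfac using hfac
  have hlt : Finset.univ.sup g < 1 := (Finset.sup_lt_iff (by simp)).2 fun j _ => hg j
  set γ := Finset.univ.sup g
  have hγ : ∀ (j : Fin J) (e : Plane → ℂ), SolvesLocal ω 0 Ω (Ωs j) e →
      supNorm (supportIn Ω (χ j)) e ≤ γ * supNorm (interface Ω (Ωs j)) e := by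
    intro j e he
    refine (hfac j e he).trans ?_
    gcongr
    exact Finset.le_sup (Finset.mem_univ j)
  refine ⟨γ, hlt, hγ, fun f u _ _ hu uglob uloc hS => ?_⟩
  have hglob : ∀ n, (∀ j, SolvesLocal ω f Ω (Ωs j) (uloc n j)) →
      IsAssembled Ω χ (uloc n) (uglob n) →
      supNorm Ω (fun x => u x - uglob n x) ≤ γ * maxErr Ωs u (uloc n) := by
    intro n hsol has
    refine (hχ.supNorm_sub_assembled_le has).trans (iSup_le fun j => ?_)
    have he := SolvesLocal.sub_left_of_solvesGlobal (hO j).1 (hO j).2 hu (hsol j)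
    refine (hγ j _ he).trans ?_
    gcongr
    exact (supNorm_interface_le he.1.1.2).trans
      (le_iSup (fun j => supNorm (Ωs j) fun x => u x - uloc n j x) j)
  have hloc : ∀ n, maxErr Ωs u (uloc (n + 1)) ≤ supNorm Ω (fun x => u x - uglob n x) := by
    intro n
    refine iSup_le fun j => ?_
    have he := SolvesLocal.sub_left_of_solvesGlobal (hO j).1 (hO j).2 hu (hS.solves n j)
    refine (he.supNorm_le_interface hΩ.isOpen hΩ.isBounded (hO j).1 (hO j).2).trans ?_
    rw [supNorm_congr (w := fun x => u x - uglob n x)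
      fun x hx => by rw [hS.transmission n j x hx]]
    exact supNorm_mono Set.inter_subset_right _
  have hgeom : ∀ n, maxErr Ωs u (uloc (n + 1)) ≤ (γ : ℝ≥0∞) ^ n * maxErr Ωs u (uloc 1) := by
    intro n
    induction n with
    | zero => simp
    | succ n ih =>
      refine ((hloc (n + 1)).trans (hglob (n + 1) (hS.solves n) (hS.assemble n))).trans ?_
      rw [pow_succ', mul_assoc]
      gcongr
  -- the geometric bound forces convergence only because the first error is finite
  have hfin : maxErr Ωs u (uloc 1) ≠ ⊤ := by
    have hfin_each : ∀ j, supNorm (Ωs j) (fun x => u x - uloc 1 j x) < ⊤ := fun j => by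
      have he := SolvesLocal.sub_left_of_solvesGlobal (hO j).1 (hO j).2 hu (hS.solves 0 j)
      rw [← supNorm_closure he.1.1.2]
      exact (supNorm_closure_ne_top (hΩ.isBounded.subset (hO j).2) he.1.1.2).lt_top
    rw [maxErr, ← Finset.sup_univ_eq_iSup]
    exact ((Finset.sup_lt_iff (by simp)).2 fun j _ => hfin_each j).ne
  have hlim : Filter.Tendsto (fun n => (γ : ℝ≥0∞) ^ n * maxErr Ωs u (uloc 1))
      Filter.atTop (nhds 0) := by
    have := ENNReal.Tendsto.mul_const (b := maxErr Ωs u (uloc 1))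
      (ENNReal.tendsto_pow_atTop_nhds_zero_of_lt_one (ENNReal.coe_lt_one_iff.2 hlt))
      (Or.inr hfin)
    simpa using this
  have hconv : Filter.Tendsto (fun n => maxErr Ωs u (uloc (n + 1))) Filter.atTop (nhds 0) :=
    tendsto_of_tendsto_of_tendsto_of_le_of_le tendsto_const_nhds hlim (fun _ => zero_le) hgeom
  refine ⟨(Filter.tendsto_add_atTop_iff_nat 1).1 hconv, ?_, hloc 0, hgeom, ?_⟩
  · refine (Filter.tendsto_add_atTop_iff_nat 1).1 ?_
    refine tendsto_of_tendsto_of_tendsto_of_le_of_le tendsto_const_nhds hconv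
      (fun _ => zero_le) fun n => ?_
    refine (hglob (n + 1) (hS.solves n) (hS.assemble n)).trans ?_
    exact mul_le_of_le_one_left' (ENNReal.coe_le_one_iff.2 hlt.le)
  · intro hsol has n
    induction n with
    | zero => simp
    | succ n ih =>
      -- the first assembly step is a hypothesis on the initial guess, the later ones belong to the
      -- method
      have hstep : supNorm Ω (fun x => u x - uglob n x) ≤ γ * maxErr Ωs u (uloc n) := by
        cases n with
        | zero => exact hglob 0 hsol has
        | succ n => exact hglob (n + 1) (hS.solves n) (hS.assemble n)
      refine ((hloc n).trans hstep).trans ?_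
      rw [pow_succ', mul_assoc]
      gcongr
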